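/- Let $P(m)=\tfrac12(m^2+3m+2)$. Exceptional slopes. For a rational number $\alpha$ let $r_\alpha$ be the smallest positive integer with $r_\alpha\alpha\in\mathbb Z$, and put $\Delta_\alpha=\tfrac12\bigl(1-\tfrac1{r_\alpha^2}\bigr)$, $x_\alpha=\tfrac12\bigl(3-\sqrt{5+8\Delta_\alpha}\bigr)$ and $I_\alpha=(\alpha-x_\alpha,\alpha+x_\alpha)\subset\mathbb R$. For rational $\alpha,\beta$ put $\alpha.\beta=\frac{\alpha+\beta}2+\frac{\Delta_\beta-\Delta_\alpha}{3+\alpha-\beta}$. The set $\mathcal E\subset\mathbb Q$ of exceptional slopes (the slopes of the exceptional bundles on $\mathbb P^2$, in Drézet's description) is the image of the function $\varepsilon:\mathbb Z[\tfrac12]\to\mathbb Q$ defined inductively by $\varepsilon(n)=n$ for $n\in\mathbb Z$ and $\varepsilon\bigl(\tfrac{2p+1}{2^{q+1}}\bigr)=\varepsilon\bigl(\tfrac p{2^q}\bigr).\varepsilon\bigl(\tfrac{p+1}{2^q}\bigr)$ for $p\in\mathbb Z$, $q\ge 0$. For $\mu\in\mathbb R$ let $$\delta(\mu)=\sup\{P(-|\mu-\alpha|)-\Delta_\alpha:\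 \alpha\in\mathcal E,\ |\mu-\alpha|<3\}.$$ Chern characters. Let $\xi=(r,\mathrm{ch}_1,\mathrm{ch}_2)$ be a Chern character on $\mathbb P^2$ of positive integer rank $r$, with slope $\mu(\xi)=\mathrm{ch}_1/r$ and discriminant $\Delta(\xi)=\tfrac12\mu(\xi)^2-\mathrm{ch}_2/r$, such that $c_1=r\mu(\xi)$ and $\chi=r\,(P(\mu(\xi))-\Delta(\xi))$ are integers and $\Delta(\xi)>\delta(\mu(\xi))$. (By theorems of Drézet and Le Potier, this is the case in which the moduli space $M(\xi)$ of semistable sheaves has Picard rank $2$.) Let $(\cdot,\cdot)$ be the pairing $(\xi,\zeta)=\chi(\xi\otimes\zeta)$ on $K(\mathbb P^2)\otimes\mathbb R$, and let $$Q_\xi=\{(\mu,\Delta)\in\mathbb R^2:\ (\xi,\zeta)=0 \text{ for the character } \zeta \text{ of rank } 1, \text{ slope } \mu \text{ and discriminant } \Delta\},$$ which is the parabola $\Delta=P(\mu(\xi)+\mu)-\Delta(\xi)$. Theorem. The parabola $Q_\xi$ meets the line $\Delta=\tfrac12$ in exactly two points. If $\mu_0$ is the larger of the two slopes with $(\mu_0,\tfrac12)\in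 Q_\xi$, then there is a unique exceptional slope $\alpha\in\mathcal E$ such that $\mu_0\in I_\alpha$. (This $\alpha$ is called the corresponding exceptional slope to $\xi$.) -/

import Mathlib

noncomputable section

namespace PlaneSheaves

/-- The Hilbert polynomial of the structure sheaf of the projective plane,
`P(m) = (m² + 3m + 2) / 2`. -/
def P (m : ℝ) : ℝ := (m ^ 2 + 3 * m + 2) / 2

/-! ### Chern characters -/

/-- An element of `K(ℙ²) ⊗ ℝ`, recorded by its Chern character `(r, ch₁, ch₂)`. -/
@[ext]
structure ChernChar where
  /-- the rank -/
  r : ℝ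
  /-- the first Chern character (equal to the first Chern class) -/
  ch1 : ℝ
  /-- the second Chern character -/
  ch2 : ℝ

namespace ChernChar

/-- The slope `μ = ch₁ / r` (for `r ≠ 0`). -/
def slope (ξ : ChernChar) : ℝ := ξ.ch1 / ξ.r

/-- The discriminant `Δ = μ² / 2 - ch₂ / r` (for `r ≠ 0`). -/
def disc (ξ : ChernChar) : ℝ := ξ.slope ^ 2 / 2 - ξ.ch2 / ξ.r

/-- The character of rank `r`, slope `μ` and discriminant `Δ`. -/
def ofInvariants (r μ Δ : ℝ) : ChernChar := ⟨r, r * μ, r * (μ ^ 2 / 2 - Δ)⟩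

/-- The Euler characteristic by Riemann-Roch: the degree-two part of `ch(ξ) · td(ℙ²)`,
where `td(ℙ²) = 1 + (3/2) H + H²`. -/
def euler (ξ : ChernChar) : ℝ := ξ.ch2 + 3 / 2 * ξ.ch1 + ξ.r

/-- The product of Chern characters, which is the character of a tensor product. -/
def tensor (ξ ζ : ChernChar) : ChernChar :=
  ⟨ξ.r * ζ.r, ξ.r * ζ.ch1 + ξ.ch1 * ζ.r, ξ.r * ζ.ch2 + ξ.ch1 * ζ.ch1 + ξ.ch2 * ζ.r⟩

/-- The bilinear pairing `(ξ, ζ) = χ(ξ^*, ζ) = χ(ξ ⊗ ζ)` on `K(ℙ²) ⊗ ℝ`. -/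
def pairing (ξ ζ : ChernChar) : ℝ := (ξ.tensor ζ).euler

/-- The orthogonal complement `ξ^⊥` for the pairing. -/
def perp (ξ : ChernChar) : Set ChernChar := {ζ | ξ.pairing ζ = 0}

/-- `ξ` is integral, i.e. lies in `K(ℙ²)`: its rank, first Chern class and Euler
characteristic are integers. -/
def IsIntegral (ξ : ChernChar) : Prop :=
  (∃ n : ℤ, ξ.r = n) ∧ (∃ n : ℤ, ξ.ch1 = n) ∧ (∃ n : ℤ, ξ.euler = n)

/-- The locus `Q_ξ = {(μ, Δ) : (1, μ, Δ) lies in ξ^⊥}` in the `(μ, Δ)`-plane. -/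
def Q (ξ : ChernChar) : Set (ℝ × ℝ) := {p | ofInvariants 1 p.1 p.2 ∈ ξ.perp}

/-- Riemann-Roch in terms of slope and discriminant. -/
theorem euler_eq (ξ : ChernChar) (h : ξ.r ≠ 0) :
    ξ.euler = ξ.r * (P ξ.slope - ξ.disc) := by
  simp only [euler, P, disc, slope]
  field_simp
  ring

/-- The pairing in terms of slopes and discriminants. -/
theorem pairing_eq (ξ ζ : ChernChar) (h : ξ.r ≠ 0) (h' : ζ.r ≠ 0) :
    ξ.pairing ζ = ξ.r * ζ.r * (P (ξ.slope + ζ.slope) - ξ.disc - ζ.disc) := by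
  simp only [pairing, tensor, euler, P, disc, slope]
  field_simp
  ring

/-- In positive rank, `Q_ξ` is the parabola `P(μ(ξ) + μ) - Δ(ξ) = Δ`. -/
theorem mem_Q_iff (ξ : ChernChar) (h : 0 < ξ.r) (μ Δ : ℝ) :
    (μ, Δ) ∈ ξ.Q ↔ P (ξ.slope + μ) - ξ.disc = Δ := by
  have h1 : ξ.pairing (ofInvariants 1 μ Δ) = ξ.r * (P (ξ.slope + μ) - ξ.disc - Δ) := by
    rw [pairing_eq ξ _ h.ne' (by simp [ofInvariants])]
    simp [ofInvariants, slope, disc]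
  simp only [Q, perp, Set.mem_ofPred_eq, h1, mul_eq_zero, h.ne', false_or, sub_eq_zero]

end ChernChar

/-! ### Exceptional slopes -/

/-- The rank `r_α` of the exceptional bundle of slope `α`: the smallest positive integer `r`
with `r α` an integer, that is, the denominator of `α` (see `isLeast_exRank`). -/
def exRank (α : ℚ) : ℕ := α.den

theorem isLeast_exRank (α : ℚ) :
    IsLeast {r : ℕ | 0 < r ∧ ∃ n : ℤ, (r : ℚ) * α = n} (exRank α) := by
  refine ⟨⟨α.den_pos, α.num, by rw [exRank, mul_comm]; exact α.mul_den_eq_num⟩, ?_⟩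
  rintro r ⟨hr, n, hn⟩
  have hr0 : (r : ℚ) ≠ 0 := by exact_mod_cast hr.ne'
  have h : α = Rat.divInt n (r : ℤ) := by
    rw [Rat.divInt_eq_div, eq_div_iff (by exact_mod_cast hr0), mul_comm]
    exact_mod_cast hn
  have h2 : (α.den : ℤ) ∣ (r : ℤ) := by
    rw [h]; exact Rat.den_dvd n r
  exact Nat.le_of_dvd hr (by exact_mod_cast h2)

/-- The discriminant `Δ_α = (1 - 1 / r_α²) / 2`. -/
def exDisc (α : ℚ) : ℚ := (1 - 1 / (exRank α : ℚ) ^ 2) / 2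

/-- The operation `α.β = (α + β) / 2 + (Δ_β - Δ_α) / (3 + α - β)`. -/
def dot (α β : ℚ) : ℚ := (α + β) / 2 + (exDisc β - exDisc α) / (3 + α - β)

/-- `eps q p` is the value `ε(p / 2 ^ q)` of the function `ε` on the dyadic integers `ℤ[1/2]`,
given by `ε(n) = n` and `ε((2p + 1) / 2 ^ (q + 1)) = ε(p / 2 ^ q) . ε((p + 1) / 2 ^ q)`
(see `eps_zero`, `eps_odd`); it depends only on the number `p / 2 ^ q` (see `eps_congr`). -/
def eps : ℕ → ℤ → ℚ
  | 0, p => p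
  | q + 1, p => if Even p then eps q (p / 2) else dot (eps q (p / 2)) (eps q (p / 2 + 1))

theorem eps_zero (n : ℤ) : eps 0 n = n := by simp [eps]

theorem eps_even (q : ℕ) (p : ℤ) : eps (q + 1) (2 * p) = eps q p := by
  simp [eps]

theorem eps_odd (q : ℕ) (p : ℤ) :
    eps (q + 1) (2 * p + 1) = dot (eps q p) (eps q (p + 1)) := by
  have h : ¬ Even (2 * p + 1) := by simp [parity_simps]
  have h2 : (2 * p + 1) / 2 = p := by omega
  simp [eps, h2]

theorem eps_shift (q k : ℕ) (p : ℤ) : eps (q + k) (2 ^ k * p) = eps q p := by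
  induction k with
  | zero => simp
  | succ k ih => rw [← add_assoc, pow_succ', mul_assoc, eps_even, ih]

theorem eps_congr (q q' : ℕ) (p p' : ℤ) (h : (p : ℚ) / 2 ^ q = p' / 2 ^ q') :
    eps q p = eps q' p' := by
  have h1 : (2 : ℤ) ^ q' * p = 2 ^ q * p' := by
    rw [div_eq_div_iff (by positivity) (by positivity)] at h
    have h2 : (2 : ℚ) ^ q' * p = 2 ^ q * p' := by linarith
    exact_mod_cast h2
  rw [← eps_shift q q' p, h1, add_comm, eps_shift]

/-- The set of exceptional slopes: the values of `ε`. -/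
def exSlopes : Set ℚ := {α | ∃ (q : ℕ) (p : ℤ), eps q p = α}

/-- The number `x_α = (3 - √(5 + 8 Δ_α)) / 2`. -/
def halfWidth (α : ℚ) : ℝ := (3 - √(5 + 8 * (exDisc α : ℝ))) / 2

/-- The interval `I_α = (α - x_α, α + x_α)`. -/
def exInterval (α : ℚ) : Set ℝ := Set.Ioo ((α : ℝ) - halfWidth α) ((α : ℝ) + halfWidth α)

/-- The function
`δ(μ) = sup {P(-|μ - α|) - Δ_α : α an exceptional slope with |μ - α| < 3}`. -/
def delta (μ : ℝ) : ℝ :=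
  sSup ((fun α : ℚ => P (-|μ - (α : ℝ)|) - (exDisc α : ℝ)) ''
    {α : ℚ | α ∈ exSlopes ∧ |μ - (α : ℝ)| < 3})

end PlaneSheaves

end

namespace PlaneSheaves

/-! ### Adjacent exceptional slopes and the Markov equation -/

/-! Write `a`, `b` for the denominators of consecutive values `α < β` of `ε`. Their gap `d`
satisfies `d(3-d) = 1/a² + 1/b²`, a form of the Markov equation preserved by `dot`, while `x_α` is
the small root of `t(3-t) = 1/a²`. Comparing the two shows that the `I_α` are pairwise disjoint,
which gives uniqueness. For existence, `μ₀` solves `(2x+h)² = S` with `h`, `S` rational and `S ≥ 9`.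
A point `x` outside all closed intervals is a limit of slopes `α` with `a²(x-α) → 1/3`
(`exists_approx`). An integral quadratic form vanishing at `x` takes integer values at these `α`, so
its limiting value is an integer; this makes `2x+h`, hence `x`, rational, which the approximation
forbids. Endpoints are excluded because `x_α` is irrational and `S ∉ [5,9)`. The same argument with
`S = 0` covers rational points, whence `δ ≥ 1/2` there and `Δ(ξ) > 1/2`. -/

/-- The Vieta step for adjacent slopes `p / a` and `q / b`: the slope between them is `e / c`. -/
theorem markov_step {p a q b w c : ℤ} (ha : 0 < a) (hk : a ∣ p ^ 2 + 1)
    (hcop : IsCoprime a b) (hw : w = q * a - p * b) (hc : c = 3 * a * b - w)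
    (hM : w * c = a ^ 2 + b ^ 2) :
    ∃ e : ℤ, e * a - p * c = b ∧ q * c - e * b = a ∧ c ∣ e ^ 2 + 1 ∧
      IsCoprime a c ∧ IsCoprime c b := by
  obtain ⟨k, hk⟩ := hk
  -- The coefficient of `a` is `(b + p * c) / a`, made integral by `p² + 1 = a * k`.
  have h1 : (3 * p * b - p * q + b * k) * a - p * c = b := by
    rw [hc, hw]; linear_combination (-b) * hk
  set e := 3 * p * b - p * q + b * k with he
  have h2 : q * c - e * b = a := by
    have : a * (q * c - e * b) = a * a := by
      linear_combination (-b) * h1 + hM - c * hw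
    exact mul_left_cancel₀ ha.ne' this
  have hac : IsCoprime a c := by
    obtain ⟨s, t, hst⟩ := hcop
    exact ⟨s + t * e, -t * p, by linear_combination hst + t * h1⟩
  have hcb : IsCoprime c b := by
    obtain ⟨s, t, hst⟩ := hcop
    exact ⟨s * q, t - s * e, by linear_combination hst + s * h2⟩
  refine ⟨e, h1, h2, ?_, hac, hcb⟩
  -- Modulo `c`, `e * a ≡ b` and `e * b ≡ -a`, so `c` divides `(e² + 1) * a * b`; then cancel `a *
  -- b`.
  have h3 : IsCoprime c (a * b) := IsCoprime.mul_right hac.symm hcb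
  refine h3.dvd_of_dvd_mul_left ⟨q * b + p * q * c - p * a, ?_⟩
  have h4 : e * a = b + p * c := by linarith
  have h5 : e * b = q * c - a := by linarith
  linear_combination (e * b) * h4 + (b + p * c) * h5

/-- The numerical properties of neighbouring exceptional slopes `α < β`. -/
structure Adjacent (α β : ℚ) : Prop where
  lt : α < β
  le_one : β - α ≤ 1
  coprime : IsCoprime (α.den : ℤ) (β.den : ℤ)
  dvd_left : (α.den : ℤ) ∣ α.num ^ 2 + 1
  dvd_right : (β.den : ℤ) ∣ β.num ^ 2 + 1
  quad : (β - α) * (3 - (β - α)) = 1 / (α.den : ℚ) ^ 2 + 1 / (β.den : ℚ) ^ 2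

/-- With `w` the determinant of the two fractions, `quad` reads `a² + b² + w² = 3abw`. The
denominator of `dot α β` is the other root `c = 3ab - w`, and the new pairs have determinants `b`
and `a`; `c ≥ 2ab` because the gap is at most `1`. -/
theorem Adjacent.dot {α β : ℚ} (h : Adjacent α β) :
    Adjacent α (dot α β) ∧ Adjacent (dot α β) β ∧
      2 * (α.den * β.den) ≤ (PlaneSheaves.dot α β).den := by
  have ha : (0 : ℤ) < α.den := by exact_mod_cast α.den_pos
  have hb : (0 : ℤ) < β.den := by exact_mod_cast β.den_pos
  have haq : (0 : ℚ) < α.den := by exact_mod_cast α.den_pos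
  have hbq : (0 : ℚ) < β.den := by exact_mod_cast β.den_pos
  have hα : α = α.num / α.den := α.num_div_den.symm
  have hβ : β = β.num / β.den := β.num_div_den.symm
  obtain ⟨w, hw⟩ : ∃ w : ℤ, w = β.num * α.den - α.num * β.den := ⟨_, rfl⟩
  obtain ⟨c, hc⟩ : ∃ c : ℤ, c = 3 * α.den * β.den - w := ⟨_, rfl⟩
  have hwq : (w : ℚ) = (β - α) * (α.den * β.den) := by
    have : (w : ℚ) = β.num * α.den - α.num * β.den := by rw [hw]; push_cast; ring
    rw [this, ← α.mul_den_eq_num, ← β.mul_den_eq_num]; ring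
  have hcq : (c : ℚ) = (3 - (β - α)) * (α.den * β.den) := by
    rw [hc]; push_cast; rw [hwq]; ring
  have hM : w * c = (α.den : ℤ) ^ 2 + (β.den : ℤ) ^ 2 := by
    have : (w * c : ℚ) = (α.den : ℚ) ^ 2 + (β.den : ℚ) ^ 2 := by
      have h1 : (w * c : ℚ) = ((β - α) * (3 - (β - α))) * (α.den * β.den) ^ 2 := by
        rw [hwq, hcq]; ring
      rw [h1, h.quad]; field_simp; ring
    exact_mod_cast this
  have hc2 : 2 * ((α.den : ℤ) * β.den) ≤ c := by
    have : (2 * (α.den * β.den) : ℚ) ≤ c := by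
      rw [hcq]; have := h.le_one
      gcongr; linarith
    exact_mod_cast this
  have hc0 : 0 < c := lt_of_lt_of_le (by positivity) hc2
  have hc0q : (0 : ℚ) < c := by exact_mod_cast hc0
  obtain ⟨e, he1, he2, he3, hac, hcb⟩ := markov_step ha h.dvd_left h.coprime hw hc hM
  have he1q : (e * α.den - α.num * c : ℚ) = β.den := by exact_mod_cast he1
  have he2q : (β.num * c - e * β.den : ℚ) = α.den := by exact_mod_cast he2
  have d1 : (e : ℚ) / c - α = β.den / (α.den * c) := by
    nth_rewrite 1 [hα]; rw [← he1q]; field_simp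
  have d2 : β - (e : ℚ) / c = α.den / (β.den * c) := by
    nth_rewrite 1 [hβ]; rw [← he2q]; field_simp
  have hMq : (w * c : ℚ) = (α.den : ℚ) ^ 2 + (β.den : ℚ) ^ 2 := by exact_mod_cast hM
  have hc' : (c : ℚ) = 3 * α.den * β.den - w := by exact_mod_cast hc
  have hdot : PlaneSheaves.dot α β = e / c := by
    have h3 : 3 + α - β = c / (α.den * β.den) := by rw [hcq]; field_simp; ring
    have h4 : (e : ℚ) / c = (α + β) / 2 + (β.den / (α.den * c) - α.den / (β.den * c)) / 2 := by
      rw [← d1, ← d2]; ring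
    rw [h4, PlaneSheaves.dot, h3, exDisc, exDisc, exRank, exRank]
    field_simp
    ring
  have hcope : IsCoprime e c := by
    obtain ⟨k, hk⟩ := he3
    exact ⟨-e, k, by linear_combination (-1) * hk⟩
  have hnum : (PlaneSheaves.dot α β).num = e := by
    rw [hdot]; exact Rat.num_div_eq_of_coprime hc0 (Int.isCoprime_iff_gcd_eq_one.1 hcope)
  have hden : ((PlaneSheaves.dot α β).den : ℤ) = c := by
    rw [hdot]; exact Rat.den_div_eq_of_coprime hc0 (Int.isCoprime_iff_gcd_eq_one.1 hcope)
  have hdenq : ((PlaneSheaves.dot α β).den : ℚ) = c := by exact_mod_cast hden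
  rw [← hdot] at d1 d2
  have p1 : 0 < (β.den : ℚ) / (α.den * c) := by positivity
  have p2 : 0 < (α.den : ℚ) / (β.den * c) := by positivity
  have hl := h.le_one
  refine ⟨⟨by linarith, by linarith, by rwa [hden], h.dvd_left, by rwa [hden, hnum], ?_⟩,
    ⟨by linarith, by linarith, by rwa [hden], by rwa [hden, hnum], h.dvd_right, ?_⟩, ?_⟩
  · rw [d1, hdenq]; field_simp
    linear_combination hMq - (c : ℚ) * hc'
  · rw [d2, hdenq]; field_simp
    linear_combination hMq - (c : ℚ) * hc'
  · zify; rw [hden]; exact hc2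

/-- `α` and `β` are consecutive values of `ε` at some dyadic level. -/
def ExPair (α β : ℚ) : Prop := ∃ (q : ℕ) (p : ℤ), eps q p = α ∧ eps q (p + 1) = β

theorem adjacent_eps (q : ℕ) (p : ℤ) : Adjacent (eps q p) (eps q (p + 1)) := by
  induction q generalizing p with
  | zero =>
    rw [eps_zero, eps_zero]
    constructor <;> norm_num
  | succ q ih =>
    obtain ⟨k, rfl | rfl⟩ := Int.even_or_odd' p
    · rw [eps_even, eps_odd]; exact (ih k).dot.1
    · rw [eps_odd, show 2 * k + 1 + 1 = 2 * (k + 1) by ring, eps_even]; exact (ih k).dot.2.1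

namespace ExPair

variable {α β : ℚ}

theorem adjacent (h : ExPair α β) : Adjacent α β := by
  obtain ⟨q, p, rfl, rfl⟩ := h; exact adjacent_eps q p

theorem left_mem (h : ExPair α β) : α ∈ exSlopes := by
  obtain ⟨q, p, rfl, rfl⟩ := h; exact ⟨q, p, rfl⟩

theorem right_mem (h : ExPair α β) : β ∈ exSlopes := by
  obtain ⟨q, p, rfl, rfl⟩ := h; exact ⟨q, p + 1, rfl⟩

theorem left_dot (h : ExPair α β) : ExPair α (dot α β) := by
  obtain ⟨q, p, rfl, rfl⟩ := h
  exact ⟨q + 1, 2 * p, eps_even q p, eps_odd q p⟩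

theorem dot_right (h : ExPair α β) : ExPair (dot α β) β := by
  obtain ⟨q, p, rfl, rfl⟩ := h
  exact ⟨q + 1, 2 * p + 1, eps_odd q p, by
    rw [show 2 * p + 1 + 1 = 2 * (p + 1) by ring, eps_even]⟩

theorem den_left_lt_dot (h : ExPair α β) : α.den < (dot α β).den := by
  have := h.adjacent.dot.2.2
  nlinarith [α.den_pos, β.den_pos]

theorem den_right_lt_dot (h : ExPair α β) : β.den < (dot α β).den := by
  have := h.adjacent.dot.2.2
  nlinarith [α.den_pos, β.den_pos]

theorem quad (h : ExPair α β) : ((β : ℝ) - α) * (3 - ((β : ℝ) - α)) =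
    1 / (α.den : ℝ) ^ 2 + 1 / (β.den : ℝ) ^ 2 := by
  have := congrArg (Rat.cast : ℚ → ℝ) h.adjacent.quad
  push_cast at this
  exact this

theorem sub_le_one (h : ExPair α β) : (β : ℝ) - α ≤ 1 := by exact_mod_cast h.adjacent.le_one

theorem lt (h : ExPair α β) : (α : ℝ) < β := by exact_mod_cast h.adjacent.lt

end ExPair

/-! ### The intervals `I_α` -/

theorem one_div_den_sq_pos (α : ℚ) : 0 < 1 / (α.den : ℝ) ^ 2 := by
  have : (0 : ℝ) < α.den := by exact_mod_cast α.den_pos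
  positivity

theorem one_div_den_sq_le_one (α : ℚ) : 1 / (α.den : ℝ) ^ 2 ≤ 1 := by
  have : (1 : ℝ) ≤ α.den := by exact_mod_cast α.den_pos
  rw [div_le_one (by positivity)]
  exact one_le_pow₀ this

theorem five_add_exDisc (α : ℚ) : 5 + 8 * (exDisc α : ℝ) = 9 - 4 * (1 / (α.den : ℝ) ^ 2) := by
  simp only [exDisc, exRank]; push_cast; ring

theorem halfWidth_eq (α : ℚ) : halfWidth α = (3 - √(9 - 4 * (1 / (α.den : ℝ) ^ 2))) / 2 := by
  rw [halfWidth, five_add_exDisc]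

/-- Together with `halfWidth_le_half`, which selects the smaller root, this replaces the square root
in later estimates. -/
theorem halfWidth_quad (α : ℚ) : halfWidth α * (3 - halfWidth α) = 1 / (α.den : ℝ) ^ 2 := by
  have h := Real.sq_sqrt (x := 9 - 4 * (1 / (α.den : ℝ) ^ 2))
    (by linarith [one_div_den_sq_le_one α])
  rw [halfWidth_eq]; linear_combination (-1 / 4) * h

theorem halfWidth_le_half (α : ℚ) : halfWidth α ≤ 1 / 2 := by
  have : 2 ≤ √(9 - 4 * (1 / (α.den : ℝ) ^ 2)) :=
    Real.le_sqrt_of_sq_le (by linarith [one_div_den_sq_le_one α])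
  rw [halfWidth_eq]; linarith

theorem halfWidth_pos (α : ℚ) : 0 < halfWidth α := by
  have h1 := halfWidth_quad α
  have h2 := one_div_den_sq_pos α
  have h3 := halfWidth_le_half α
  by_contra! h
  nlinarith

theorem mem_exInterval_iff (α : ℚ) (x : ℝ) : x ∈ exInterval α ↔ |x - α| < halfWidth α := by
  rw [exInterval, Set.mem_Ioo, abs_lt]
  constructor <;> rintro ⟨h1, h2⟩ <;> constructor <;> linarith

theorem ExPair.halfWidth_add_le {α β : ℚ} (h : ExPair α β) :
    (α : ℝ) + halfWidth α ≤ β - halfWidth β := by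
  have h1 := halfWidth_quad α
  have h2 := halfWidth_quad β
  have h3 := h.quad
  have h4 := h.sub_le_one
  have h5 := mul_pos (halfWidth_pos α) (halfWidth_pos β)
  have h6 := halfWidth_le_half α
  have h7 := halfWidth_le_half β
  by_contra! hlt
  -- With `σ` the sum of the half widths and `d` the gap, this product is `σ(3-σ) - d(3-d)`, which
  -- equals `-2 * halfWidth α * halfWidth β < 0`.
  have h8 : 0 < (halfWidth α + halfWidth β - ((β : ℝ) - α)) *
      (3 - (halfWidth α + halfWidth β) - ((β : ℝ) - α)) :=
    mul_pos (by linarith) (by linarith)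
  linarith

theorem eps_halfWidth_add_le (q : ℕ) (p : ℤ) (n : ℕ) :
    (eps q p : ℝ) + halfWidth (eps q p) ≤
      eps q (p + n + 1) - halfWidth (eps q (p + n + 1)) := by
  induction n with
  | zero => simpa using ExPair.halfWidth_add_le ⟨q, p, rfl, rfl⟩
  | succ n ih =>
    have h := ExPair.halfWidth_add_le (α := eps q (p + n + 1)) ⟨q, p + n + 1, rfl, rfl⟩
    have := halfWidth_pos (eps q (p + n + 1))
    push_cast
    rw [show p + ((n : ℤ) + 1) + 1 = p + n + 1 + 1 by ring]
    linarith

theorem exInterval_inter_unique {α β : ℚ} (hα : α ∈ exSlopes) (hβ : β ∈ exSlopes) {x : ℝ}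
    (hxα : x ∈ exInterval α) (hxβ : x ∈ exInterval β) : α = β := by
  obtain ⟨q, p, rfl⟩ := hα
  obtain ⟨q', p', rfl⟩ := hβ
  -- Both slopes are moved to the common dyadic level `q + q'`, where the intervals are ordered by
  -- index.
  rw [← eps_shift q q' p] at *
  rw [← eps_shift q' q p', add_comm q' q] at *
  generalize (2 : ℤ) ^ q' * p = s at *
  generalize (2 : ℤ) ^ q * p' = t at *
  have key : ∀ s t : ℤ, x ∈ exInterval (eps (q + q') s) → x ∈ exInterval (eps (q + q') t) →
      ¬ s < t := by
    intro s t hs ht hst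
    obtain ⟨n, hn⟩ := Int.le.dest (Int.add_one_le_iff.2 hst)
    have := eps_halfWidth_add_le (q + q') s n
    rw [show s + n + 1 = t by omega] at this
    exact absurd (hs.2.trans_le this) (not_lt.2 ht.1.le)
  rw [le_antisymm (not_lt.1 (key _ _ hxβ hxα)) (not_lt.1 (key _ _ hxα hxβ))]

/-! ### Approximation of points outside the closed intervals -/

section Approximation

variable {x : ℝ} (hx : ∀ α ∈ exSlopes, halfWidth α < |x - α|)
include hx

theorem ne_of_mem_exSlopes {α : ℚ} (hα : α ∈ exSlopes) : x ≠ α := by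
  rintro rfl
  have := hx α hα
  simp only [sub_self, abs_zero] at this
  linarith [halfWidth_pos α]

theorem exists_exPair_around : ∃ α β : ℚ, ExPair α β ∧ (α : ℝ) < x ∧ x < β := by
  refine ⟨_, _, ⟨0, ⌊x⌋, rfl, rfl⟩, ?_, ?_⟩
  · refine lt_of_le_of_ne ?_ (ne_of_mem_exSlopes hx ⟨0, ⌊x⌋, rfl⟩).symm
    rw [eps_zero]; exact_mod_cast Int.floor_le x
  · rw [eps_zero]; exact_mod_cast Int.lt_floor_add_one x

theorem halfWidth_lt_sub {α : ℚ} (hα : α ∈ exSlopes) (h : (α : ℝ) < x) :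
    halfWidth α < x - α := by
  simpa [abs_of_pos (sub_pos.2 h)] using hx α hα

theorem halfWidth_lt_sub' {α : ℚ} (hα : α ∈ exSlopes) (h : x < (α : ℝ)) :
    halfWidth α < α - x := by
  simpa [abs_of_neg (sub_neg.2 h)] using hx α hα

omit hx in
/-- If `y` exceeds the half width of `α`, then pairs of diameter more than `y` with `α` as one of
the two slopes have bounded ranks. -/
theorem exists_bound_of_halfWidth_lt {α : ℚ} {y : ℝ} (hy : halfWidth α < y) (hy1 : y ≤ 1) :
    ∃ n : ℕ, ∀ d : ℝ, ∀ m : ℕ, y < d → d ≤ 1 → n ≤ m →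
      d * (3 - d) ≠ 1 / (α.den : ℝ) ^ 2 + 1 / (m : ℝ) ^ 2 := by
  have h1 := halfWidth_quad α
  have h2 : 0 < y * (3 - y) - 1 / (α.den : ℝ) ^ 2 := by
    rw [← h1]; nlinarith
  obtain ⟨n, hn⟩ := exists_nat_one_div_lt h2
  refine ⟨n + 1, fun d m hd hd1 hm h => ?_⟩
  have hm1 : (n : ℝ) + 1 ≤ m := by exact_mod_cast hm
  have hn0 : (0 : ℝ) ≤ n := n.cast_nonneg
  have h3 : 1 / (m : ℝ) ^ 2 ≤ 1 / ((n : ℝ) + 1) :=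
    one_div_le_one_div_of_le (by positivity) (by nlinarith)
  nlinarith

/-- Subdivide by `dot` around `x`. If `α` were never replaced, the right denominators would be
unbounded and the gap would shrink to `halfWidth α`, yet it exceeds `x - α > halfWidth α`. -/
theorem exists_exPair_den_left_lt {α β : ℚ} (h : ExPair α β) (hαx : (α : ℝ) < x) (hxβ : x < β) :
    ∃ α' β' : ℚ, ExPair α' β' ∧ (α' : ℝ) < x ∧ x < β' ∧ α.den < α'.den ∧ β.den ≤ β'.den := by
  by_contra! hcon
  have key : ∀ n : ℕ, ∃ β' : ℚ, ExPair α β' ∧ x < β' ∧ β.den ≤ β'.den ∧ n ≤ β'.den := by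
    intro n
    induction n with
    | zero => exact ⟨β, h, hxβ, le_rfl, Nat.zero_le _⟩
    | succ n ih =>
      obtain ⟨β', h', hx', hb, hn⟩ := ih
      have hd := h'.den_right_lt_dot
      rcases lt_or_gt_of_ne (ne_of_mem_exSlopes hx h'.left_dot.right_mem) with hlt | hgt
      · exact ⟨_, h'.left_dot, hlt, by omega, by omega⟩
      · have := hcon _ _ h'.dot_right hgt hx' h'.den_left_lt_dot
        omega
  have hy := halfWidth_lt_sub hx h.left_mem hαx
  obtain ⟨n, hn⟩ := exists_bound_of_halfWidth_lt hy (by linarith [h.sub_le_one])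
  obtain ⟨β', h', hx', -, hm⟩ := key n
  exact hn _ _ (by linarith) h'.sub_le_one hm h'.quad

theorem exists_exPair_den_right_lt {α β : ℚ} (h : ExPair α β) (hαx : (α : ℝ) < x) (hxβ : x < β) :
    ∃ α' β' : ℚ, ExPair α' β' ∧ (α' : ℝ) < x ∧ x < β' ∧ α.den ≤ α'.den ∧ β.den < β'.den := by
  by_contra! hcon
  have key : ∀ n : ℕ, ∃ α' : ℚ, ExPair α' β ∧ (α' : ℝ) < x ∧ α.den ≤ α'.den ∧ n ≤ α'.den := by
    intro n
    induction n with
    | zero => exact ⟨α, h, hαx, le_rfl, Nat.zero_le _⟩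
    | succ n ih =>
      obtain ⟨α', h', hx', hb, hn⟩ := ih
      have hd := h'.den_left_lt_dot
      rcases lt_or_gt_of_ne (ne_of_mem_exSlopes hx h'.left_dot.right_mem) with hlt | hgt
      · exact absurd (hcon _ _ h'.left_dot hx' hlt hb) (not_le.2 h'.den_right_lt_dot)
      · exact ⟨_, h'.dot_right, hgt, by omega, by omega⟩
  have hy := halfWidth_lt_sub' hx h.right_mem hxβ
  obtain ⟨n, hn⟩ := exists_bound_of_halfWidth_lt hy (by linarith [h.sub_le_one])
  obtain ⟨α', h', hx', -, hm⟩ := key n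
  exact hn _ _ (by linarith) h'.sub_le_one hm (by rw [h'.quad]; ring)

theorem exists_exPair_den_ge (n : ℕ) :
    ∃ α β : ℚ, ExPair α β ∧ (α : ℝ) < x ∧ x < β ∧ n ≤ α.den ∧ n ≤ β.den := by
  induction n with
  | zero =>
    obtain ⟨α, β, h, h1, h2⟩ := exists_exPair_around hx
    exact ⟨α, β, h, h1, h2, Nat.zero_le _, Nat.zero_le _⟩
  | succ n ih =>
    obtain ⟨α, β, h, h1, h2, h3, h4⟩ := ih
    obtain ⟨α', β', h', h1', h2', h3', h4'⟩ := exists_exPair_den_left_lt hx h h1 h2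
    obtain ⟨α'', β'', h'', h1'', h2'', h3'', h4''⟩ := exists_exPair_den_right_lt hx h' h1' h2'
    exact ⟨α'', β'', h'', h1'', h2'', by omega, by omega⟩

/-- A point outside the closed intervals is approximated from the left by exceptional slopes
with Lagrange constant exactly `1 / 3`. -/
theorem exists_approx (n : ℕ) : ∃ α : ℚ, n + 1 ≤ α.den ∧
    1 / 3 ≤ (α.den : ℝ) ^ 2 * (x - α) ∧
      (α.den : ℝ) ^ 2 * (x - α) ≤ 1 / (3 - 2 / ((n : ℝ) + 1)) := by
  obtain ⟨α, β, h, h1, h2, h3, h4⟩ := exists_exPair_den_ge hx (n + 1)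
  have ha : (0 : ℝ) < (α.den : ℝ) ^ 2 := by
    have : (0 : ℝ) < α.den := by exact_mod_cast α.den_pos
    positivity
  have hn0 : (0 : ℝ) ≤ n := n.cast_nonneg
  have bound : ∀ m : ℕ, n + 1 ≤ m → 1 / (m : ℝ) ^ 2 ≤ 1 / ((n : ℝ) + 1) := by
    intro m hm
    have hm1 : (n : ℝ) + 1 ≤ m := by exact_mod_cast hm
    exact one_div_le_one_div_of_le (by positivity) (by nlinarith)
  have hu := bound _ h3
  have hv := bound _ h4
  have hX := halfWidth_lt_sub hx h.left_mem h1
  have hY := halfWidth_lt_sub' hx h.right_mem h2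
  have qX := halfWidth_quad α
  have qY := halfWidth_quad β
  have pX := halfWidth_pos α
  have pY := halfWidth_pos β
  have lY := halfWidth_le_half β
  have hd := h.quad
  have hd1 := h.sub_le_one
  have hd0 := h.lt
  have hu' : (α.den : ℝ) ^ 2 * (1 / (α.den : ℝ) ^ 2) = 1 := by field_simp
  have hn1 : 1 / ((n : ℝ) + 1) ≤ 1 := by rw [div_le_one (by positivity)]; linarith
  refine ⟨α, h3, ?_, ?_⟩
  · have : 1 / (α.den : ℝ) ^ 2 ≤ 3 * (x - α) := by nlinarith
    nlinarith
  · set t := 1 / ((n : ℝ) + 1) with ht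
    rw [show 2 / ((n : ℝ) + 1) = 2 * t by rw [ht]; ring]
    rw [le_div_iff₀ (by linarith)]
    have b1 : (β : ℝ) - α ≤ t := by nlinarith
    have b2 : halfWidth β ≤ t := by nlinarith
    -- The left side is `d(3-d) - Y(3-Y)` for the gap `d` and `Y = halfWidth β`, and `x - α < d -
    -- Y`.
    have b3 : ((β : ℝ) - α - halfWidth β) * (3 - ((β : ℝ) - α) - halfWidth β) =
        1 / (α.den : ℝ) ^ 2 := by linarith
    have b4 : (x - α) * (3 - 2 * t) ≤ 1 / (α.den : ℝ) ^ 2 := by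
      rw [← b3]
      apply mul_le_mul <;> linarith
    calc (α.den : ℝ) ^ 2 * (x - α) * (3 - 2 * t)
        = (α.den : ℝ) ^ 2 * ((x - α) * (3 - 2 * t)) := by ring
      _ ≤ (α.den : ℝ) ^ 2 * (1 / (α.den : ℝ) ^ 2) := by gcongr
      _ = 1 := hu'

theorem exists_approx_seq : ∃ u : ℕ → ℚ, Filter.Tendsto (fun n => ((u n : ℚ) : ℝ)) .atTop (nhds x) ∧
    Filter.Tendsto (fun n => ((u n).den : ℝ) ^ 2 * (x - u n)) .atTop (nhds (1 / 3)) := by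
  choose u hu1 hu2 hu3 using exists_approx hx
  have t0 := tendsto_one_div_add_atTop_nhds_zero_nat (𝕜 := ℝ)
  have t1 : Filter.Tendsto (fun n : ℕ => 1 / (3 - 2 / ((n : ℝ) + 1))) .atTop (nhds (1 / 3)) := by
    have := ((t0.const_mul 2).const_sub 3).inv₀ (by norm_num)
    simpa [div_eq_mul_inv] using this
  refine ⟨u, ?_, tendsto_of_tendsto_of_tendsto_of_le_of_le tendsto_const_nhds t1 hu2 hu3⟩
  rw [tendsto_iff_norm_sub_tendsto_zero]
  refine squeeze_zero (fun _ => norm_nonneg _) (fun n => ?_) t0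
  have hn0 : (0 : ℝ) ≤ n := n.cast_nonneg
  have hn1 : 1 / ((n : ℝ) + 1) ≤ 1 := by rw [div_le_one (by positivity)]; linarith
  have ha : (n : ℝ) + 1 ≤ (u n).den := by exact_mod_cast hu1 n
  have h1 : ((u n).den : ℝ) ^ 2 * (x - u n) ≤ 1 := by
    refine (hu3 n).trans ?_
    rw [show 2 / ((n : ℝ) + 1) = 2 * (1 / ((n : ℝ) + 1)) by ring, div_le_one (by linarith)]
    linarith
  have h0 : 0 ≤ x - u n := by
    by_contra! h
    have := hu2 n
    nlinarith [sq_nonneg ((u n).den : ℝ)]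
  rw [Real.norm_eq_abs, abs_sub_comm, abs_of_nonneg h0, le_div_iff₀ (by positivity)]
  have : (n : ℝ) + 1 ≤ ((u n).den : ℝ) ^ 2 := by nlinarith
  nlinarith

/-- Distinct rationals differ by at least the inverse product of their denominators, too much for an
approximant of larger denominator within `1 / α.den²`. -/
theorem ne_rat_of_forall_halfWidth_lt (y : ℚ) : x ≠ y := by
  rintro rfl
  obtain ⟨α, h1, h2, h3⟩ := exists_approx hx y.den
  have hy : (1 : ℝ) ≤ y.den := by exact_mod_cast y.den_pos
  have ha : (y.den : ℝ) + 1 ≤ α.den := by exact_mod_cast h1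
  have h4 : (α.den : ℝ) ^ 2 * (y - α) ≤ 1 := by
    refine h3.trans ?_
    have : 2 / ((y.den : ℝ) + 1) ≤ 2 := by
      rw [div_le_iff₀ (by positivity)]; linarith
    rw [div_le_one (by linarith)]; linarith
  obtain ⟨k, hk⟩ : ∃ k : ℤ, k = y.num * α.den - α.num * y.den := ⟨_, rfl⟩
  have hkr : (k : ℝ) = (y - α) * (y.den * α.den) := by
    have e1 : (y.num : ℝ) = y * y.den := by exact_mod_cast y.mul_den_eq_num.symm
    have e2 : (α.num : ℝ) = α * α.den := by exact_mod_cast α.mul_den_eq_num.symm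
    rw [hk]; push_cast; rw [e1, e2]; ring
  have hpos : (0 : ℝ) < y - α := by
    by_contra! h
    nlinarith [sq_nonneg (α.den : ℝ)]
  have hk0 : 0 < k := by
    have : (0 : ℝ) < k := by rw [hkr]; positivity
    exact_mod_cast this
  have hk1 : (1 : ℝ) ≤ k := by exact_mod_cast hk0
  rw [hkr] at hk1
  have h5 : (y.den : ℝ) * α.den < (α.den : ℝ) ^ 2 := by nlinarith
  nlinarith

/-- A point outside the closed intervals is not a quadratic irrational: a primitive integral
quadratic form would take the value `√D / 3` in the limit. -/
theorem exists_rat_eq_of_forall_halfWidth_lt {h S : ℚ} {s : ℝ} (hs : s = 2 * x + h) (hS : s ^ 2 = S) :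
    ∃ t : ℚ, s = t := by
  obtain ⟨u, hu1, hu2⟩ := exists_approx_seq hx
  set N : ℤ := h.den ^ 2 * S.den with hN
  -- Since `s - (2α + h) = 2(x - α)`, the right side is `N * α.den² * ((2α + h)² - S)`.
  have hint : ∀ α : ℚ, ∃ k : ℤ,
      (k : ℝ) = N * ((α.den : ℝ) ^ 2 * (x - α)) * (-2 * (2 * α + h + s)) := by
    intro α
    refine ⟨S.den * (2 * α.num * h.den + h.num * α.den) ^ 2 -
      h.den ^ 2 * S.num * α.den ^ 2, ?_⟩
    have e1 : (h.num : ℝ) = h * h.den := by exact_mod_cast h.mul_den_eq_num.symm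
    have e2 : (α.num : ℝ) = α * α.den := by exact_mod_cast α.mul_den_eq_num.symm
    have e3 : (S.num : ℝ) = S * S.den := by exact_mod_cast S.mul_den_eq_num.symm
    rw [hN]; push_cast; rw [e1, e2, e3, ← hS, hs]; ring
  choose k hk using hint
  have hlim : Filter.Tendsto (fun n => (k (u n) : ℝ)) .atTop
      (nhds (N * (1 / 3) * (-2 * (s + s)))) := by
    simp only [hk]
    refine (hu2.const_mul _).mul (Filter.Tendsto.const_mul _ (Filter.Tendsto.add_const s ?_))
    rw [hs]
    exact (hu1.const_mul 2).add_const _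
  -- The integers are closed in `ℝ`, so the limit `-4Ns/3` is an integer `m`.
  obtain ⟨m, hm⟩ := Int.isClosedEmbedding_coe_real.isClosed_range.mem_of_tendsto hlim
    (Filter.Eventually.of_forall fun n => ⟨k (u n), rfl⟩)
  have hN0 : (N : ℝ) ≠ 0 := by
    have := h.den_pos
    have := S.den_pos
    exact_mod_cast (by positivity : N ≠ 0)
  refine ⟨-3 * m / (4 * N), ?_⟩
  push_cast
  rw [hm]; field_simp; ring

end Approximation

/-! ### Endpoints -/

/-- Rationality would make `9a² - 4` a square, but it lies strictly between `(3a-1)²` and `(3a)²`.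
-/
theorem halfWidth_ne_rat (α : ℚ) (t : ℚ) : halfWidth α ≠ t := by
  intro h
  have h1 := halfWidth_quad α
  have ha : (1 : ℤ) ≤ α.den := by exact_mod_cast α.den_pos
  have ha0 : (α.den : ℚ) ≠ 0 := by exact_mod_cast α.den_ne_zero
  rw [h] at h1
  have h2 : t * (3 - t) = 1 / (α.den : ℚ) ^ 2 := by
    apply Rat.cast_injective (α := ℝ)
    push_cast
    exact h1
  have h3 : IsSquare (((9 * (α.den : ℤ) ^ 2 - 4 : ℤ)) : ℚ) := by
    refine ⟨(3 - 2 * t) * α.den, ?_⟩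
    field_simp at h2
    push_cast
    linear_combination 4 * h2
  rw [Rat.isSquare_intCast_iff] at h3
  obtain ⟨r, hr⟩ := h3
  have h4 : |r| * |r| = 9 * (α.den : ℤ) ^ 2 - 4 := by rw [abs_mul_abs_self, hr]
  have h5 := abs_nonneg r
  have h6 : |r| < 3 * α.den := by nlinarith
  nlinarith

/-- Every real number `x` with `(2 x + h) ^ 2 = S`, where `h` and `S` are rational and
`S ∉ [5, 9)`, lies in some `I_α`. -/
theorem exists_mem_exInterval {x : ℝ} {h S : ℚ} (hxS : (2 * x + h) ^ 2 = S)
    (hS : S < 5 ∨ 9 ≤ S) : ∃ α ∈ exSlopes, x ∈ exInterval α := by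
  by_contra! hcon
  simp only [mem_exInterval_iff, not_lt] at hcon
  have hx : ∀ α ∈ exSlopes, halfWidth α < |x - α| := by
    intro α hα
    refine lt_of_le_of_ne (hcon α hα) fun heq => ?_
    obtain ⟨ε, hε, hxε⟩ : ∃ ε : ℚ, ε ^ 2 = 1 ∧ x = α + ε * halfWidth α := by
      rcases abs_choice (x - α) with h1 | h1
      · exact ⟨1, by norm_num, by rw [heq, h1]; push_cast; ring⟩
      · exact ⟨-1, by norm_num, by rw [heq, h1]; push_cast; ring⟩
    have hε' : (ε : ℝ) ^ 2 = 1 := by exact_mod_cast hε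
    have hq := halfWidth_quad α
    -- `(2 x + h) ^ 2` is affine in the half width, with slope proportional to `ρ`
    set ρ : ℚ := 2 * α + h + 3 * ε with hρ
    have e1 : (S : ℝ) = ρ ^ 2 - 2 * ρ * ε * (3 - 2 * halfWidth α) +
        (9 - 4 * (1 / (α.den : ℝ) ^ 2)) := by
      rw [← hxS, hxε, ← hq, hρ]; push_cast
      linear_combination (4 * halfWidth α ^ 2 - 12 * halfWidth α + 9) * hε'
    by_cases hρ0 : ρ = 0
    -- Here `S = 9 - 4/a²`, which lies in the excluded range `[5, 9)`.
    · rw [hρ0] at e1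
      have u0 := one_div_den_sq_pos α
      have u1 := one_div_den_sq_le_one α
      rcases hS with hS | hS
      · have : (S : ℝ) < 5 := by exact_mod_cast hS
        push_cast at e1; linarith
      · have : (9 : ℝ) ≤ S := by exact_mod_cast hS
        push_cast at e1; linarith
    -- Otherwise `e1` can be solved for the half width, making it rational.
    · have hε0 : ε ≠ 0 := by rintro rfl; norm_num at hε
      refine halfWidth_ne_rat α ((S - ρ ^ 2 - 9 + 4 / α.den ^ 2 + 6 * ρ * ε) / (4 * ρ * ε)) ?_
      have a1 : (ρ : ℝ) ≠ 0 := by exact_mod_cast hρ0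
      have a2 : (ε : ℝ) ≠ 0 := by exact_mod_cast hε0
      push_cast
      rw [eq_div_iff (by positivity)]
      linear_combination (-1) * e1
  obtain ⟨t, ht⟩ := exists_rat_eq_of_forall_halfWidth_lt hx (s := 2 * x + h) rfl hxS
  refine ne_rat_of_forall_halfWidth_lt hx ((t - h) / 2) ?_
  push_cast; linarith

/-! ### The bound `δ ≥ 1/2` at rational slopes -/

theorem rat_mem_exInterval (y : ℚ) : ∃ α ∈ exSlopes, (y : ℝ) ∈ exInterval α :=
  exists_mem_exInterval (h := -2 * y) (S := 0) (by push_cast; ring) (Or.inl (by norm_num))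

theorem P_sub_exDisc_eq (t : ℝ) (α : ℚ) :
    P (-t) - exDisc α = 1 / 2 + (1 / (α.den : ℝ) ^ 2 - t * (3 - t)) / 2 := by
  have := five_add_exDisc α
  rw [P]; linear_combination (-1 / 8) * this

/-- On rational slopes `δ ≥ 1 / 2`. -/
theorem half_le_delta (y : ℚ) : 1 / 2 ≤ delta y := by
  obtain ⟨α, hα, hy⟩ := rat_mem_exInterval y
  rw [mem_exInterval_iff] at hy
  have hw := halfWidth_le_half α
  have hq := halfWidth_quad α
  have h0 := abs_nonneg ((y : ℝ) - α)
  -- The bound `1` holds since `t(3-t) ≥ 0` for `0 ≤ t < 3` and `1/b² ≤ 1`; without boundedness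
  -- `sSup` would be a default value.
  refine le_csSup_of_le ⟨1, ?_⟩ ⟨α, ⟨hα, by linarith⟩, rfl⟩ ?_
  · rintro _ ⟨β, ⟨-, hβ⟩, rfl⟩
    have h1 := one_div_den_sq_le_one β
    have h2 := abs_nonneg ((y : ℝ) - β)
    dsimp only
    rw [P_sub_exDisc_eq]
    nlinarith
  · dsimp only
    rw [P_sub_exDisc_eq]
    nlinarith

theorem ChernChar.IsIntegral.exists_rat {ξ : ChernChar} (h : ξ.IsIntegral) :
    ∃ m D : ℚ, ξ.slope = m ∧ ξ.disc = D := by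
  obtain ⟨⟨r, hr⟩, ⟨c, hc⟩, ⟨e, he⟩⟩ := h
  have h2 : ξ.ch2 = e - 3 / 2 * c - r := by rw [← he, ChernChar.euler, hr, hc]; ring
  refine ⟨c / r, (c / r) ^ 2 / 2 - (e - 3 / 2 * c - r) / r, ?_, ?_⟩
  · rw [ChernChar.slope, hr, hc]; push_cast; rfl
  · rw [ChernChar.disc, ChernChar.slope, hr, hc, h2]; push_cast; rfl

end PlaneSheaves

theorem mainTheorem2 (ξ : PlaneSheaves.ChernChar) (hint : ξ.IsIntegral) (hr : 0 < ξ.r)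
    (hΔ : PlaneSheaves.delta ξ.slope < ξ.disc) :
    ∃ μ₁ μ₀ : ℝ, μ₁ < μ₀ ∧
      ξ.Q ∩ {p : ℝ × ℝ | p.2 = 1 / 2} = {(μ₁, 1 / 2), (μ₀, 1 / 2)} ∧
      ∃! α : ℚ, α ∈ PlaneSheaves.exSlopes ∧ μ₀ ∈ PlaneSheaves.exInterval α := by
  obtain ⟨m, D, hm, hD⟩ := hint.exists_rat
  have hD2 : 1 / 2 < (D : ℝ) := by
    rw [← hD]; rw [hm] at hΔ
    exact (PlaneSheaves.half_le_delta m).trans_lt hΔ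
  have hs0 : 0 < √(5 + 8 * (D : ℝ)) := Real.sqrt_pos.2 (by linarith)
  have hs : √(5 + 8 * (D : ℝ)) ^ 2 = 5 + 8 * D := Real.sq_sqrt (by linarith)
  set s := √(5 + 8 * (D : ℝ))
  refine ⟨(-3 - s) / 2 - m, (-3 + s) / 2 - m, by linarith, ?_, ?_⟩
  · ext ⟨μ, Δ⟩
    simp only [Set.mem_inter_iff, PlaneSheaves.ChernChar.mem_Q_iff ξ hr, Set.mem_ofPred_eq,
      Set.mem_insert_iff, Set.mem_singleton_iff, Prod.mk.injEq, hm, hD, PlaneSheaves.P]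
    rw [← or_and_right, and_congr_left_iff]
    rintro rfl
    rw [← sub_eq_zero (a := μ), ← sub_eq_zero (a := μ), ← mul_eq_zero, ← sub_eq_zero]
    have : (μ - ((-3 - s) / 2 - m)) * (μ - ((-3 + s) / 2 - m)) =
        2 * (((m + μ) ^ 2 + 3 * (m + μ) + 2) / 2 - D - 1 / 2) := by
      linear_combination (-1 / 4) * hs
    rw [this]; simp
  · have hD3 : (1 / 2 : ℚ) < D := by
      have : ((1 / 2 : ℚ) : ℝ) < D := by push_cast; exact hD2
      exact_mod_cast this
    -- `2μ₀ + 3 + 2m = s`, and `D > 1/2` gives `S = s² > 9`.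
    obtain ⟨α, hα, hx⟩ := PlaneSheaves.exists_mem_exInterval (x := (-3 + s) / 2 - m)
      (h := 3 + 2 * m) (S := 5 + 8 * D) (by push_cast; rw [← hs]; ring) (Or.inr (by linarith))
    exact ⟨α, ⟨hα, hx⟩, fun β hβ => PlaneSheaves.exInterval_inter_unique hβ.1 hα hβ.2 hx⟩
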